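/- **Theorem.** The butterfly networks $F^k$ ($k\ge 0$) are the directed graphs defined recursively as follows. $F^0$ is a single vertex, which is its only target, without edges. If $F^k$ has the $m=2^k$ targets $t_0,\dots,t_{m-1}$ (in this order), then $F^{k+1}$ consists of two disjoint copies $A$ and $B$ of $F^k$, with targets $t_0,\dots,t_{m-1}$ and $t_m,\dots,t_{2m-1}$ respectively, of $2m$ additional vertices $v_0,\dots,v_{2m-1}$, which are the targets of $F^{k+1}$ in this order, and of the additional edges $(t_i,v_i)$, $(t_i,v_{i+m})$, $(t_{i+m},v_i)$, $(t_{i+m},v_{i+m})$ for $0\le i<m$. A butterfly network of height $h$ on a vertex set $V$ is a directed graph on $V$ that is isomorphic to $F^h$; then $n=|V|=2^h(h+1)$. A path query $(u,v)$ to an unknown directed graph $G$ on a known vertex set $V$ returns whether $G$ contains a directed path (possibly of length $0$) from $u$ to $v$. A randomized query algorithm on $V$ asks path queries adaptively and finally outputs a directed graph on $V$. A butterfly network of height $h$ can be learned exactly with $O(2^{3h/2}h^2)$ path queries with high probability. That is, for every $c\in\mathbb N$ there is a constant $C$ such that, for every $h\ge 0$ and every finite vertex set $V$, there is a randomized query algorithm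 on $V$ such that, for every butterfly network $G$ of height $h$ on $V$, the algorithm with path queries to $G$ always asks at most $C\cdot 2^{3h/2}h^2$ queries and, with probability at least $1-1/|V|^{c}$, outputs $G$. -/

import Mathlib

namespace Butterfly

/-- The number of targets of the butterfly network `F^k` (it equals `2 ^ k`). -/
def numTargets : ℕ → ℕ
  | 0 => 1
  | k + 1 => numTargets k + numTargets k

/-- The vertices of `F^k`. `F^0` has a single vertex; the vertex set of `F^(k+1)` is the disjoint
union of the vertex sets of two copies `A`, `B` of `F^k` and of `2 m` additional vertices
`v_0, …, v_(2m-1)`, where `m` is the number of targets of `F^k`. -/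
inductive Vertex : ℕ → Type
  | single : Vertex 0
  | inA {k : ℕ} (x : Vertex k) : Vertex (k + 1)
  | inB {k : ℕ} (x : Vertex k) : Vertex (k + 1)
  | inC {k : ℕ} (j : Fin (numTargets k + numTargets k)) : Vertex (k + 1)

/-- The ordered list of the targets of `F^k`: the single vertex if `k = 0`, and otherwise the
additional vertices `v_0, …, v_(2m-1)` of the last step, in this order. -/
def target : (k : ℕ) → Fin (numTargets k) → Vertex k
  | 0, _ => Vertex.single
  | _ + 1, j => Vertex.inC j

/-- The edges of `F^k`. `F^0` has none; `F^(k+1)` has the edges of the two copies of `F^k` and, for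
`0 ≤ i < m`, the edges `(t_i, v_i)`, `(t_i, v_(i+m))`, `(t_(i+m), v_i)`, `(t_(i+m), v_(i+m))`, where
`t_0, …, t_(m-1)` are the targets of the copy `A` and `t_m, …, t_(2m-1)` those of the copy `B`. -/
inductive Edge : (k : ℕ) → Vertex k → Vertex k → Prop
  | inA {k : ℕ} {x y : Vertex k} (e : Edge k x y) : Edge (k + 1) (.inA x) (.inA y)
  | inB {k : ℕ} {x y : Vertex k} (e : Edge k x y) : Edge (k + 1) (.inB x) (.inB y)
  | straightA {k : ℕ} (i : Fin (numTargets k)) :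
      Edge (k + 1) (.inA (target k i)) (.inC (Fin.castAdd (numTargets k) i))
  | crossA {k : ℕ} (i : Fin (numTargets k)) :
      Edge (k + 1) (.inA (target k i)) (.inC (Fin.natAdd (numTargets k) i))
  | crossB {k : ℕ} (i : Fin (numTargets k)) :
      Edge (k + 1) (.inB (target k i)) (.inC (Fin.castAdd (numTargets k) i))
  | straightB {k : ℕ} (i : Fin (numTargets k)) :
      Edge (k + 1) (.inB (target k i)) (.inC (Fin.natAdd (numTargets k) i))

/-- The butterfly network (depth-`k` FFT graph) `F^k` as a directed graph. -/
def network (k : ℕ) : Digraph (Vertex k) where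
  Adj := Edge k

end Butterfly

/-- `G` is a butterfly network of height `h`: it is `F^h` up to the names of the vertices. -/
def IsButterfly {V : Type*} (h : ℕ) (G : Digraph V) : Prop :=
  Nonempty ((Butterfly.network h).Adj ≃r G.Adj)

open Classical in
/-- The path query: is there a directed path from `u` to `v` in `G`?  A vertex has the path of
length `0` to itself. -/
noncomputable def pathQuery {V : Type*} (G : Digraph V) (u v : V) : Bool :=
  decide (Relation.ReflTransGen G.Adj u v)

/-- A deterministic adaptive query algorithm on the known vertex set `V`: it either stops with a
directed graph on `V` as its output, or asks a query about a pair of vertices and proceeds in a way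
that depends on the answer. -/
inductive QueryAlg (V : Type*) where
  | output (G : Digraph V) : QueryAlg V
  | query (u v : V) (next : Bool → QueryAlg V) : QueryAlg V

namespace QueryAlg

/-- The output of the algorithm when its queries are answered by `oracle`. -/
def run {V : Type*} (oracle : V → V → Bool) : QueryAlg V → Digraph V
  | output G => G
  | query u v next => run oracle (next (oracle u v))

/-- The total number of queries that the algorithm asks when they are answered by `oracle`. -/
def numQueries {V : Type*} (oracle : V → V → Bool) : QueryAlg V → ℕ
  | output _ => 0
  | query u v next => numQueries oracle (next (oracle u v)) + 1

end QueryAlg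

/-- A randomized adaptive query algorithm on the known vertex set `V`: a deterministic one that is
drawn at random (all random choices are made in advance, independently of the unknown graph). -/
abbrev RandQueryAlg (V : Type*) := PMF (QueryAlg V)

namespace RandQueryAlg

/-- The probability that the randomized algorithm `A`, with path queries to `G`, outputs `G`. -/
noncomputable def successProb {V : Type*} (A : RandQueryAlg V) (G : Digraph V) : ℝ :=
  (PMF.toOuterMeasure A {T | T.run (pathQuery G) = G}).toReal

/-- With path queries to `G`, the randomized algorithm `A` never asks more than `q` queries,
whatever its random choices are. -/
def QueriesAtMost {V : Type*} (A : RandQueryAlg V) (G : Digraph V) (q : ℝ) : Prop :=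
  ∀ T ∈ PMF.support A, (T.numQueries (pathQuery G) : ℝ) ≤ q

end RandQueryAlg

/-! Give each vertex a rank and an `h`-bit address so that an edge leaving rank `r` can change only
bit `r`. Then `v` is reachable from `u` exactly when `L.le u v`: ranks do not decrease, and the
addresses agree outside the positions from the rank of `u` up to, but excluding, that of `v`. Paths
between two vertices are therefore unique, and the ancestors of a vertex form a binary tree.

Once the ancestors of `m` are known, an in-neighbour of `m` is found by asking for the path from
some ancestor to `m` and sorting it (`Learn.find_parent`). The two in-neighbours split the ancestors
into halves, so every further level costs the same `O(2^h)` (`Learn.explore_up`).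

The saving comes from treating vertices in groups. The `2^w` twins of `v` are exactly the starting
points of the paths of length `w` to one common descendant, and their out-edges all lie on paths to
two such descendants, so three explorations learn all of them (`Learn.learn_twins`). Vertices of
large rank are treated in the reversed network. The groups partition the vertices, so there are at
most `(h + 1) * 2^(h - w)` of them, each costing `O(h 2^h)`; with `w = ⌈h / 2⌉` this gives `O(h^2
2^(3h/2))`. The strategy is deterministic and never fails. -/

namespace Butterfly

/-! ### Coordinates for the recursively defined network -/

/-- Coordinates of the butterfly network of height `h` on `V`: every vertex is determined by its
rank (its layer) and an `h`-bit address, and all combinations occur. -/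
@[ext]
structure Labeling (h : ℕ) (V : Type*) where
  rank : V → ℕ
  bit : V → Fin h → Bool
  rank_le : ∀ v, rank v ≤ h
  eq_of_rank_of_bit : ∀ u v, rank u = rank v → bit u = bit v → u = v
  exists_mk : ∀ k ≤ h, ∀ f : Fin h → Bool, ∃ v, rank v = k ∧ bit v = f

namespace Labeling

variable {h : ℕ} {V : Type*} (L : Labeling h V)

/-- Reachability in the butterfly network with the coordinates `L`. -/
def le (u v : V) : Prop :=
  L.rank u ≤ L.rank v ∧
    ∀ i : Fin h, ((i : ℕ) < L.rank u ∨ L.rank v ≤ i) → L.bit u i = L.bit v i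

/-- `v` can be reached from `u` by a path of length `k`. -/
def step (k : ℕ) (u v : V) : Prop :=
  L.rank v = L.rank u + k ∧ L.le u v

/-- The edges of the butterfly network with the coordinates `L`. -/
def adj (u v : V) : Prop := L.step 1 u v

end Labeling

lemma numTargets_eq (k : ℕ) : numTargets k = 2 ^ k := by
  induction k with
  | zero => rfl
  | succ k ih => rw [numTargets, ih]; ring

/-- The layer of a vertex of `F^k`. -/
def Vertex.rank : {k : ℕ} → Vertex k → ℕ
  | _, .single => 0
  | _, .inA x => x.rank
  | _, .inB x => x.rank
  | k + 1, .inC _ => k + 1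

/-- The address of a vertex of `F^k`, as a number with `k` bits. -/
def Vertex.code : {k : ℕ} → Vertex k → ℕ
  | _, .single => 0
  | _, .inA x => x.code
  | k + 1, .inB x => x.code + 2 ^ k
  | _, .inC j => j

lemma Vertex.rank_le {k : ℕ} (x : Vertex k) : x.rank ≤ k := by
  induction x with
  | single => exact le_rfl
  | inA x ih => simp only [Vertex.rank]; omega
  | inB x ih => simp only [Vertex.rank]; omega
  | inC j => simp only [Vertex.rank]; omega

lemma Vertex.code_lt {k : ℕ} (x : Vertex k) : x.code < 2 ^ k := by
  induction x with
  | single => simp [Vertex.code]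
  | inA x ih => simp only [Vertex.code]; omega
  | inB x ih => simp only [Vertex.code]; omega
  | @inC k j =>
    have := j.2
    have h2 := numTargets_eq k
    simp only [Vertex.code]; omega

lemma Vertex.eq_of_rank_of_code {k : ℕ} (x y : Vertex k) (hr : x.rank = y.rank)
    (hc : x.code = y.code) : x = y := by
  induction x with
  | single => cases y; rfl
  | inA x ih =>
    cases y with
    | inA y => rw [ih y hr hc]
    | inB y => have := x.code_lt; simp only [Vertex.code] at hc; omega
    | inC j => have := x.rank_le; simp only [Vertex.rank] at hr; omega
  | inB x ih =>
    cases y with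
    | inA y => have := y.code_lt; simp only [Vertex.code] at hc; omega
    | inB y => rw [ih y hr (by simpa [Vertex.code] using hc)]
    | inC j => have := x.rank_le; simp only [Vertex.rank] at hr; omega
  | inC j =>
    cases y with
    | inA y => have := y.rank_le; simp only [Vertex.rank] at hr; omega
    | inB y => have := y.rank_le; simp only [Vertex.rank] at hr; omega
    | inC j' => rw [Fin.ext hc]

lemma Vertex.exists_rank_code {k : ℕ} (r c : ℕ) (hr : r ≤ k) (hc : c < 2 ^ k) :
    ∃ x : Vertex k, x.rank = r ∧ x.code = c := by
  induction k generalizing c with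
  | zero => exact ⟨.single, by simp [Vertex.rank]; omega, by simp [Vertex.code]; omega⟩
  | succ k ih =>
    by_cases hrk : r = k + 1
    · have h2 := numTargets_eq k
      exact ⟨.inC ⟨c, by omega⟩, by simp only [Vertex.rank, hrk], rfl⟩
    · by_cases hck : c < 2 ^ k
      · obtain ⟨x, hx⟩ := ih c (by omega) hck
        exact ⟨.inA x, hx⟩
      · obtain ⟨x, hx1, hx2⟩ := ih (c - 2 ^ k) (by omega) (by omega)
        exact ⟨.inB x, hx1, by simp only [Vertex.code]; omega⟩

lemma rank_target (k : ℕ) (i : Fin (numTargets k)) : (target k i).rank = k := by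
  cases k <;> rfl

lemma code_target (k : ℕ) (i : Fin (numTargets k)) : (target k i).code = i := by
  cases k with
  | zero => have := i.2; simp only [numTargets] at this; simp only [target, Vertex.code]; omega
  | succ k => rfl

lemma eq_target_of_rank {k : ℕ} {x : Vertex k} (hx : x.rank = k) : ∃ i, x = target k i := by
  have h1 := numTargets_eq k
  have h2 := x.code_lt
  exact ⟨⟨x.code, by omega⟩,
    Vertex.eq_of_rank_of_code _ _ (by rw [rank_target, hx]) (by rw [code_target])⟩

lemma testBit_add_two_pow {a k : ℕ} (ha : a < 2 ^ k) (i : ℕ) :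
    (a + 2 ^ k).testBit i = (decide (i = k) || a.testBit i) := by
  have := Nat.two_pow_add_eq_or_of_lt ha 1
  rw [mul_one] at this
  rw [add_comm, this, Nat.testBit_or, Nat.testBit_two_pow]
  simp [eq_comm]

lemma eq_or_eq_of_testBit {k a b : ℕ} (ha : a < 2 ^ k) (hb : b < 2 ^ (k + 1))
    (hab : ∀ i, i ≠ k → a.testBit i = b.testBit i) : b = a ∨ b = a + 2 ^ k := by
  have key : ∀ c, c < 2 ^ k → (∀ i, i ≠ k → a.testBit i = c.testBit i) → c = a := by
    intro c hc h
    apply Nat.eq_of_testBit_eq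
    intro i
    by_cases hi : i = k
    · rw [hi, Nat.testBit_lt_two_pow hc, Nat.testBit_lt_two_pow ha]
    · exact (h i hi).symm
  by_cases h1 : b < 2 ^ k
  · exact Or.inl (key b h1 hab)
  · right
    have h2 : b - 2 ^ k < 2 ^ k := by omega
    have := key (b - 2 ^ k) h2 fun i hi => by
      rw [hab i hi]
      have := testBit_add_two_pow h2 i
      rw [Nat.sub_add_cancel (by omega)] at this
      simpa [hi] using this
    omega

/-- Passing to copy `B` sets bit `k` of the code and passing to copy `A` leaves it clear. The new
edges into the last layer keep the lower bits and allow bit `k` to take either value; the older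
edges never touch it. -/
lemma edge_iff {k : ℕ} (x y : Vertex k) :
    Edge k x y ↔ y.rank = x.rank + 1 ∧
      ∀ i, i ≠ x.rank → x.code.testBit i = y.code.testBit i := by
  constructor
  · intro e
    induction e with
    | inA e ih => exact ih
    | @inB k x y e ih =>
      refine ⟨ih.1, fun i hi => ?_⟩
      simp only [Vertex.code]
      rw [testBit_add_two_pow x.code_lt, testBit_add_two_pow y.code_lt, ih.2 i hi]
    | @straightA k i | @crossA k i | @crossB k i | @straightB k i =>
      have h1 := numTargets_eq k
      have h2 : (i : ℕ) < 2 ^ k := by have := i.2; omega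
      refine ⟨by simp [Vertex.rank, rank_target], fun j hj => ?_⟩
      simp only [Vertex.rank, rank_target] at hj
      simp [Vertex.code, code_target, h1, testBit_add_two_pow h2, hj]
  · rintro ⟨hr, hb⟩
    induction x with
    | single => cases y; simp [Vertex.rank] at hr
    | @inA k x ih =>
      have hx := x.code_lt
      have hxr := x.rank_le
      cases y with
      | inA y => exact .inA (ih y hr hb)
      | inB y =>
        have hyr := y.rank_le
        simp only [Vertex.rank, Vertex.code] at hr hb
        have := hb k (by omega)
        rw [testBit_add_two_pow y.code_lt, Nat.testBit_lt_two_pow hx] at this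
        simp at this
      | inC j =>
        simp only [Vertex.rank, Vertex.code] at hr hb
        have h1 := numTargets_eq k
        have hrk : x.rank = k := by omega
        obtain ⟨i, rfl⟩ := eq_target_of_rank hrk
        rw [code_target] at *
        rcases eq_or_eq_of_testBit hx (by have := j.2; omega) (hrk ▸ hb) with h | h
        · have : j = Fin.castAdd (numTargets k) i := Fin.ext (by simpa using h)
          exact this ▸ .straightA i
        · have : j = Fin.natAdd (numTargets k) i :=
            Fin.ext (by simp only [Fin.val_natAdd]; omega)
          exact this ▸ .crossA i
    | @inB k x ih =>
      have hx := x.code_lt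
      have hxr := x.rank_le
      cases y with
      | inB y =>
        refine .inB (ih y hr fun i hi => ?_)
        simp only [Vertex.rank, Vertex.code] at hr hb
        have := hb i hi
        rw [testBit_add_two_pow y.code_lt, testBit_add_two_pow hx] at this
        by_cases hik : i = k
        · rw [hik, Nat.testBit_lt_two_pow hx, Nat.testBit_lt_two_pow y.code_lt]
        · simpa [hik] using this
      | inA y =>
        have hyr := y.rank_le
        simp only [Vertex.rank, Vertex.code] at hr hb
        have := hb k (by omega)
        rw [testBit_add_two_pow hx, Nat.testBit_lt_two_pow y.code_lt] at this
        simp at this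
      | inC j =>
        simp only [Vertex.rank, Vertex.code] at hr hb
        have h1 := numTargets_eq k
        have hrk : x.rank = k := by omega
        obtain ⟨i, rfl⟩ := eq_target_of_rank hrk
        rw [code_target] at *
        have hb' : ∀ l, l ≠ k → (i : ℕ).testBit l = (j : ℕ).testBit l := by
          intro l hi
          have := hb l (by rwa [hrk])
          rw [testBit_add_two_pow hx] at this
          simpa [hi] using this
        rcases eq_or_eq_of_testBit hx (by have := j.2; omega) hb' with h | h
        · have : j = Fin.castAdd (numTargets k) i := Fin.ext (by simpa using h)
          exact this ▸ .crossB i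
        · have : j = Fin.natAdd (numTargets k) i :=
            Fin.ext (by simp only [Fin.val_natAdd]; omega)
          exact this ▸ .straightB i
    | @inC k j => have := y.rank_le; simp only [Vertex.rank] at hr; omega

lemma exists_testBit_eq {h : ℕ} (f : Fin h → Bool) :
    ∃ c < 2 ^ h, (fun i : Fin h => c.testBit i) = f := by
  refine ⟨Nat.ofBits f, Nat.ofBits_lt_two_pow f, ?_⟩
  funext i
  simp

lemma exists_labeling {V : Type*} {h : ℕ} {G : Digraph V} (hG : IsButterfly h G) :
    ∃ L : Labeling h V, ∀ u v, G.Adj u v ↔ L.adj u v := by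
  obtain ⟨f⟩ := hG
  have ext_code : ∀ x y : Vertex h, (∀ i : Fin h, x.code.testBit i = y.code.testBit i) →
      x.code = y.code := by
    intro x y hxy
    apply Nat.eq_of_testBit_eq
    intro i
    by_cases hi : i < h
    · exact hxy ⟨i, hi⟩
    · have : 2 ^ h ≤ 2 ^ i := Nat.pow_le_pow_right (by norm_num) (by omega)
      rw [Nat.testBit_lt_two_pow (x.code_lt.trans_le this),
        Nat.testBit_lt_two_pow (y.code_lt.trans_le this)]
  refine ⟨⟨fun v => (f.symm v).rank, fun v i => (f.symm v).code.testBit i,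
    fun v => Vertex.rank_le _, fun u v hr hb => ?_, fun k hk g => ?_⟩, fun u v => ?_⟩
  · exact f.symm.injective (Vertex.eq_of_rank_of_code _ _ hr (ext_code _ _ (congrFun hb)))
  · obtain ⟨c, hc, rfl⟩ := exists_testBit_eq g
    obtain ⟨x, rfl, rfl⟩ := Vertex.exists_rank_code k c hk hc
    exact ⟨f x, by simp, by simp⟩
  · rw [← f.symm.map_rel_iff]
    change Edge h _ _ ↔ _
    rw [edge_iff]
    simp only [Labeling.adj, Labeling.step, Labeling.le]
    refine and_congr_right fun hr => ⟨fun hb => ⟨by omega, fun i hi => hb i (by omega)⟩,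
      fun hb i hi => ?_⟩
    by_cases hih : i < h
    · exact hb.2 ⟨i, hih⟩ (by simp only; omega)
    · have : 2 ^ h ≤ 2 ^ i := Nat.pow_le_pow_right (by norm_num) (by omega)
      rw [Nat.testBit_lt_two_pow ((f.symm u).code_lt.trans_le this),
        Nat.testBit_lt_two_pow ((f.symm v).code_lt.trans_le this)]

end Butterfly

/-! ### Reachability, unique paths and ancestor trees -/

namespace Butterfly
namespace Labeling

variable {h : ℕ} {V : Type*} (L : Labeling h V)

/-- The coordinates of the reversed network. -/
def dual : Labeling h V where
  rank v := h - L.rank v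
  bit v i := L.bit v i.rev
  rank_le _ := Nat.sub_le _ _
  eq_of_rank_of_bit u v hr hb := by
    refine L.eq_of_rank_of_bit u v ?_ (funext fun i => ?_)
    · have := L.rank_le u
      have := L.rank_le v
      omega
    · simpa using congrFun hb i.rev
  exists_mk k hk f := by
    obtain ⟨v, hv, hb⟩ := L.exists_mk (h - k) (Nat.sub_le _ _) (f ∘ Fin.rev)
    exact ⟨v, by omega, funext fun i => by simp [hb]⟩

@[simp] lemma rank_dual (v : V) : L.dual.rank v = h - L.rank v := rfl

@[simp] lemma bit_dual (v : V) (i : Fin h) : L.dual.bit v i = L.bit v i.rev := rfl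

@[simp] lemma dual_dual : L.dual.dual = L := by
  ext v i
  · have := L.rank_le v
    simp only [rank_dual]
    omega
  · simp

lemma le_of_dual {u v : V} (huv : L.dual.le u v) : L.le v u := by
  have h1 := L.rank_le u
  have h2 := L.rank_le v
  obtain ⟨hr, hb⟩ := huv
  simp only [rank_dual, bit_dual] at hr hb
  refine ⟨by omega, fun i hi => ?_⟩
  have := hb i.rev (by simp only [Fin.val_rev]; omega)
  simpa using this.symm

@[simp] lemma le_dual {u v : V} : L.dual.le u v ↔ L.le v u :=
  ⟨L.le_of_dual, fun huv => L.dual.le_of_dual (by rwa [dual_dual])⟩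

@[simp] lemma step_dual {k : ℕ} {u v : V} : L.dual.step k u v ↔ L.step k v u := by
  have h1 := L.rank_le u
  have h2 := L.rank_le v
  simp only [step, le_dual, rank_dual]
  refine and_congr_left fun huv => ?_
  have := huv.1
  omega

@[simp] lemma adj_dual {u v : V} : L.dual.adj u v ↔ L.adj v u := L.step_dual

variable {L}

lemma le_refl (v : V) : L.le v v := ⟨le_rfl, fun _ _ => rfl⟩

lemma le_trans {u v w : V} (huv : L.le u v) (hvw : L.le v w) : L.le u w := by
  have h1 := huv.1
  have h2 := hvw.1
  exact ⟨by omega, fun i hi => (huv.2 i (by omega)).trans (hvw.2 i (by omega))⟩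

lemma eq_of_le_of_rank {u v : V} (huv : L.le u v) (hr : L.rank v ≤ L.rank u) : u = v := by
  have h1 := huv.1
  exact L.eq_of_rank_of_bit u v (by omega) (funext fun i => huv.2 i (by omega))

lemma rank_lt {u v : V} (huv : L.le u v) (hne : u ≠ v) : L.rank u < L.rank v := by
  by_contra hr
  exact hne (eq_of_le_of_rank huv (by omega))

lemma step_zero {u v : V} (huv : L.step 0 u v) : u = v :=
  eq_of_le_of_rank huv.2 huv.1.le

lemma step_refl (v : V) : L.step 0 v v := ⟨rfl, le_refl v⟩

lemma step_trans {k l : ℕ} {u v w : V} (huv : L.step k u v) (hvw : L.step l v w) :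
    L.step (k + l) u w :=
  ⟨by rw [hvw.1, huv.1]; ring, le_trans huv.2 hvw.2⟩

lemma adj_step {k : ℕ} {u v w : V} (huv : L.adj u v) (hvw : L.step k v w) :
    L.step (k + 1) u w := by
  rw [add_comm]; exact step_trans huv hvw

lemma step_adj {k : ℕ} {u v w : V} (huv : L.step k u v) (hvw : L.adj v w) :
    L.step (k + 1) u w := step_trans huv hvw

/-- The last vertex before `m` on the path has taken over the bits of `m` below its own rank and
still carries the bits of `x` from there on. -/
lemma exists_le_adj {x m : V} (hxm : L.le x m) (hne : x ≠ m) : ∃ p, L.adj p m ∧ L.le x p := by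
  have hlt := rank_lt hxm hne
  have hm := L.rank_le m
  obtain ⟨p, hr, hb⟩ := L.exists_mk (L.rank m - 1) (by omega)
    fun i => if (i : ℕ) < L.rank m - 1 then L.bit m i else L.bit x i
  refine ⟨p, ⟨by omega, by omega, fun i hi => ?_⟩, by omega, fun i hi => ?_⟩
  · rw [hb]
    dsimp only
    split_ifs with hlt
    · rfl
    · exact hxm.2 i (by omega)
  · rw [hb]
    dsimp only
    split_ifs with hlt
    · exact hxm.2 i (by omega)
    · rfl

lemma reflTransGen_adj_iff {u v : V} : Relation.ReflTransGen L.adj u v ↔ L.le u v := by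
  constructor
  · intro huv
    induction huv with
    | refl => exact le_refl u
    | tail _ hbc ih => exact le_trans ih hbc.2
  · intro huv
    obtain ⟨k, hk⟩ : ∃ k, k = L.rank v := ⟨_, rfl⟩
    induction k generalizing v with
    | zero =>
      have := huv.1
      rw [eq_of_le_of_rank huv (by omega)]
    | succ k ih =>
      by_cases hne : u = v
      · rw [hne]
      · obtain ⟨p, hp, hup⟩ := exists_le_adj huv hne
        exact (ih hup (by have := hp.1; omega)).tail hp

lemma step_succ {k : ℕ} {u v : V} (huv : L.step (k + 1) u v) :
    ∃ p, L.step k u p ∧ L.adj p v := by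
  obtain ⟨p, hp, hup⟩ := exists_le_adj huv.2 (by rintro rfl; have := huv.1; omega)
  have h1 := huv.1
  have h2 := hp.1
  exact ⟨p, ⟨by omega, hup⟩, hp⟩

lemma step_succ' {k : ℕ} {u v : V} (huv : L.step (k + 1) u v) :
    ∃ c, L.adj u c ∧ L.step k c v := by
  obtain ⟨c, hc⟩ := step_succ (L := L.dual) (L.step_dual.2 huv)
  exact ⟨c, by simpa [and_comm] using hc⟩

lemma exists_step {k : ℕ} {u : V} (hk : L.rank u + k ≤ h) : ∃ v, L.step k u v := by
  obtain ⟨v, hr, hb⟩ := L.exists_mk _ hk (L.bit u)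
  exact ⟨v, hr, by omega, fun i _ => by rw [hb]⟩

/-- Two different in-neighbours of a vertex have no common ancestor. -/
lemma parent_unique {x p q m : V} (hp : L.adj p m) (hq : L.adj q m) (hxp : L.le x p)
    (hxq : L.le x q) : p = q := by
  have h1 := hp.1
  have h2 := hq.1
  refine L.eq_of_rank_of_bit p q (by omega) (funext fun i => ?_)
  by_cases hi : (i : ℕ) = L.rank p
  · rw [← hxp.2 i (by omega), ← hxq.2 i (by omega)]
  · rw [hp.2.2 i (by omega), hq.2.2 i (by omega)]

lemma exists_two_parents {m : V} (hm : 1 ≤ L.rank m) :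
    ∃ p q, p ≠ q ∧ L.adj p m ∧ L.adj q m ∧ ∀ r, L.adj r m → r = p ∨ r = q := by
  have hmh := L.rank_le m
  have key : ∀ b : Bool, ∃ p, L.adj p m ∧ L.bit p ⟨L.rank m - 1, by omega⟩ = b := by
    intro b
    obtain ⟨p, hr, hb⟩ := L.exists_mk (L.rank m - 1) (by omega)
      (Function.update (L.bit m) ⟨L.rank m - 1, by omega⟩ b)
    refine ⟨p, ⟨by omega, by omega, fun i hi => ?_⟩, by simp [hb]⟩
    rw [hb, Function.update_of_ne]
    intro h
    have : (i : ℕ) = L.rank m - 1 := by rw [h]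
    omega
  have uniq : ∀ r s, L.adj r m → L.adj s m →
      L.bit r ⟨L.rank m - 1, by omega⟩ = L.bit s ⟨L.rank m - 1, by omega⟩ → r = s := by
    intro r s hr hs hrs
    have h1 := hr.1
    have h2 := hs.1
    refine L.eq_of_rank_of_bit r s (by omega) (funext fun i => ?_)
    by_cases hi : (i : ℕ) = L.rank m - 1
    · have : i = ⟨L.rank m - 1, by omega⟩ := Fin.ext hi
      rw [this, hrs]
    · rw [hr.2.2 i (by omega), hs.2.2 i (by omega)]
  obtain ⟨p, hp, hpb⟩ := key true
  obtain ⟨q, hq, hqb⟩ := key false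
  refine ⟨p, q, fun h => by rw [h, hqb] at hpb; simp at hpb, hp, hq, fun r hr => ?_⟩
  cases hb : L.bit r ⟨L.rank m - 1, by omega⟩ with
  | true => exact Or.inl (uniq r p hr hp (hb.trans hpb.symm))
  | false => exact Or.inr (uniq r q hr hq (hb.trans hqb.symm))

/-- Between `x` and `m` everything but `m` lies above the in-neighbour of `m` above `x`. -/
lemma le_parent {x y p m : V} (hp : L.adj p m) (hxp : L.le x p) (hxy : L.le x y)
    (hym : L.le y m) (hne : y ≠ m) : L.le y p := by
  obtain ⟨q, hq, hyq⟩ := exists_le_adj hym hne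
  rwa [parent_unique hp hq hxp (le_trans hxy hyq)]

/-- Below its rank an intermediate vertex has the bits of `m`, from its rank on those of `x`. An
interval is thus a single path with one vertex per rank. -/
lemma rank_injOn_interval {x m y z : V} (hxy : L.le x y) (hym : L.le y m) (hxz : L.le x z)
    (hzm : L.le z m) (hr : L.rank y = L.rank z) : y = z := by
  refine L.eq_of_rank_of_bit y z hr (funext fun i => ?_)
  by_cases hi : (i : ℕ) < L.rank y
  · rw [hym.2 i (by omega), hzm.2 i (by omega)]
  · rw [← hxy.2 i (by omega), ← hxz.2 i (by omega)]

open Classical in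
/-- There are `2 ^ (k + 1) - 1` vertices from which a vertex of rank `k` can be reached. -/
lemma card_ancestors [Fintype V] {k : ℕ} {m : V} (hm : L.rank m = k) :
    (Finset.univ.filter fun x => L.le x m).card + 1 = 2 ^ (k + 1) := by
  induction k generalizing m with
  | zero =>
    have : (Finset.univ.filter fun x => L.le x m) = {m} := by
      ext x
      simp only [Finset.mem_filter, Finset.mem_univ, true_and, Finset.mem_singleton]
      exact ⟨fun hx => eq_of_le_of_rank hx (by omega), fun hx => hx ▸ le_refl _⟩
    rw [this]; rfl
  | succ k ih =>
    obtain ⟨p, q, hpq, hp, hq, hall⟩ := exists_two_parents (L := L) (m := m) (by omega)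
    have : (Finset.univ.filter fun x => L.le x m) = insert m
        ((Finset.univ.filter fun x => L.le x p) ∪ (Finset.univ.filter fun x => L.le x q)) := by
      ext x
      simp only [Finset.mem_filter, Finset.mem_univ, true_and, Finset.mem_insert,
        Finset.mem_union]
      constructor
      · intro hx
        by_cases hxm : x = m
        · exact Or.inl hxm
        · obtain ⟨r, hr, hxr⟩ := exists_le_adj hx hxm
          rcases hall r hr with rfl | rfl
          · exact Or.inr (Or.inl hxr)
          · exact Or.inr (Or.inr hxr)
      · rintro (rfl | hx | hx)
        · exact le_refl _
        · exact le_trans hx hp.2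
        · exact le_trans hx hq.2
    have h1 := hp.1
    have h2 := hq.1
    rw [this, Finset.card_insert_of_notMem, Finset.card_union_of_disjoint]
    · have := ih (m := p) (by omega)
      have := ih (m := q) (by omega)
      rw [pow_succ]
      omega
    · rw [Finset.disjoint_left]
      intro x hx hx'
      simp only [Finset.mem_filter, Finset.mem_univ, true_and] at hx hx'
      exact hpq (parent_unique hp hq hx hx')
    · simp only [Finset.mem_filter, Finset.mem_univ, true_and, Finset.mem_union, not_or]
      exact ⟨fun hx => by have := hx.1; omega, fun hx => by have := hx.1; omega⟩

/-! ### Twins -/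

/-- The vertices of the same rank as `v` whose addresses differ from that of `v` at most in the
`w` positions from this rank on. -/
def twin (L : Labeling h V) (w : ℕ) (v x : V) : Prop :=
  L.rank x = L.rank v ∧
    ∀ i : Fin h, ((i : ℕ) < L.rank v ∨ L.rank v + w ≤ i) → L.bit v i = L.bit x i

lemma twin_symm {w : ℕ} {v x : V} (hx : L.twin w v x) : L.twin w x v :=
  ⟨hx.1.symm, fun i hi => (hx.2 i (by rwa [hx.1] at hi)).symm⟩

/-- A path of length `w` can rewrite precisely the positions in which twins may differ. One
descendant `m` therefore identifies all twins of `v`. -/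
lemma twin_iff_step {w : ℕ} {v x m : V} (hv : L.step w v m) :
    L.twin w v x ↔ L.step w x m := by
  obtain ⟨h1, h2⟩ := hv
  constructor
  · rintro ⟨h3, h4⟩
    refine ⟨by omega, by omega, fun i hi => ?_⟩
    rw [← h4 i (by omega), h2.2 i (by omega)]
  · rintro ⟨h3, h4⟩
    refine ⟨by omega, fun i hi => ?_⟩
    rw [h4.2 i (by omega), h2.2 i (by omega)]

/-- Every out-neighbour of a twin of `v` lies below one of two vertices, reached through the two
out-neighbours of `v`. -/
lemma twin_adj_step {w : ℕ} {v c c' m m' x z : V} (hcc : c ≠ c') (hc : L.adj v c)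
    (hc' : L.adj v c') (hm : L.step w c m) (hm' : L.step w c' m') (hx : L.twin (w + 1) v x)
    (hz : L.adj x z) : L.step w z m ∨ L.step w z m' := by
  obtain ⟨b1, b2⟩ := hc
  obtain ⟨b1', b2'⟩ := hc'
  obtain ⟨a1, a2⟩ := hm
  obtain ⟨a1', a2'⟩ := hm'
  obtain ⟨x1, x2⟩ := hx
  obtain ⟨z1, z2⟩ := hz
  have hlt : L.rank v < h := by have := L.rank_le c; omega
  have main : ∀ e n, L.rank e = L.rank v + 1 → L.le v e → L.rank n = L.rank e + w → L.le e n →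
      L.bit z ⟨L.rank v, hlt⟩ = L.bit e ⟨L.rank v, hlt⟩ → L.step w z n := by
    intro e n e1 e2 n1 n2 hb
    refine ⟨by omega, by omega, fun i hi => ?_⟩
    by_cases hi' : (i : ℕ) = L.rank v
    · have : i = ⟨L.rank v, hlt⟩ := Fin.ext hi'
      rw [← n2.2 i (by omega), this, hb]
    · rw [← n2.2 i (by omega), ← e2.2 i (by omega), x2 i (by omega), z2.2 i (by omega)]
  by_cases hb : L.bit z ⟨L.rank v, hlt⟩ = L.bit c ⟨L.rank v, hlt⟩
  · exact Or.inl (main c m b1 b2 a1 a2 hb)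
  · refine Or.inr (main c' m' b1' b2' a1' a2' ?_)
    have : L.bit c ⟨L.rank v, hlt⟩ ≠ L.bit c' ⟨L.rank v, hlt⟩ := by
      intro heq
      refine hcc (L.eq_of_rank_of_bit c c' (by omega) (funext fun i => ?_))
      by_cases hi' : (i : ℕ) = L.rank v
      · have : i = ⟨L.rank v, hlt⟩ := Fin.ext hi'
        rw [this, heq]
      · rw [← b2.2 i (by omega), ← b2'.2 i (by omega)]
    revert hb this
    cases L.bit z ⟨L.rank v, hlt⟩ <;> cases L.bit c ⟨L.rank v, hlt⟩ <;>
      cases L.bit c' ⟨L.rank v, hlt⟩ <;> simp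

open Classical in
/-- A vertex of rank at least `w` can be reached from exactly `2 ^ w` vertices by a path of
length `w`. -/
lemma card_step [Fintype V] {w : ℕ} {m : V} (hm : w ≤ L.rank m) :
    (Finset.univ.filter fun x => L.step w x m).card = 2 ^ w := by
  induction w generalizing m with
  | zero =>
    have : (Finset.univ.filter fun x => L.step 0 x m) = {m} := by
      ext x
      simp only [Finset.mem_filter, Finset.mem_univ, true_and, Finset.mem_singleton]
      exact ⟨step_zero, fun hx => hx ▸ step_refl _⟩
    rw [this]; rfl
  | succ w ih =>
    obtain ⟨p, q, hpq, hp, hq, hall⟩ := exists_two_parents (L := L) (m := m) (by omega)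
    have : (Finset.univ.filter fun x => L.step (w + 1) x m) =
        (Finset.univ.filter fun x => L.step w x p) ∪
          (Finset.univ.filter fun x => L.step w x q) := by
      ext x
      simp only [Finset.mem_filter, Finset.mem_univ, true_and, Finset.mem_union]
      constructor
      · intro hx
        obtain ⟨r, hxr, hr⟩ := step_succ hx
        rcases hall r hr with rfl | rfl
        · exact Or.inl hxr
        · exact Or.inr hxr
      · rintro (hx | hx)
        · exact step_adj hx hp
        · exact step_adj hx hq
    have h1 := hp.1
    have h2 := hq.1
    rw [this, Finset.card_union_of_disjoint, ih (by omega), ih (by omega)]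
    · ring
    · rw [Finset.disjoint_left]
      intro x hx hx'
      simp only [Finset.mem_filter, Finset.mem_univ, true_and] at hx hx'
      exact hpq (parent_unique hp hq hx.2 hx'.2)

open Classical in
lemma card_twin [Fintype V] {w : ℕ} {v : V} (hv : L.rank v + w ≤ h) :
    (Finset.univ.filter fun x => L.twin w v x).card = 2 ^ w := by
  obtain ⟨m, hm⟩ := exists_step hv
  rw [← card_step (L := L) (m := m) (by have := hm.1; omega)]
  congr 1
  ext x
  simp [twin_iff_step hm]

/-- A network of height `h` has at most `(h + 1) * 2 ^ h` vertices. -/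
lemma card_le [Fintype V] (L : Labeling h V) : Fintype.card V ≤ (h + 1) * 2 ^ h := by
  have := Fintype.card_le_of_injective
    (fun v : V => ((⟨L.rank v, Nat.lt_succ_of_le (L.rank_le v)⟩ : Fin (h + 1)), L.bit v))
    (fun u v huv => by
      simp only [Prod.mk.injEq, Fin.mk.injEq] at huv
      exact L.eq_of_rank_of_bit u v huv.1 huv.2)
  simpa using this

end Labeling
end Butterfly

/-! ### Decision trees over classes of labelings -/

namespace Butterfly

variable {h : ℕ} {V : Type*}

/-- A network that belongs to the known class `S` can be learned with `q` path queries. -/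
inductive Learn : Set (Labeling h V) → ℕ → Prop
  | done {S : Set (Labeling h V)} {q : ℕ}
      (hS : ∀ L ∈ S, ∀ L' ∈ S, ∀ u v, L.adj u v → L'.adj u v) : Learn S q
  | ask {S : Set (Labeling h V)} {q : ℕ} (u v : V) (h₁ : Learn {L | L ∈ S ∧ L.le u v} q)
      (h₂ : Learn {L | L ∈ S ∧ ¬ L.le u v} q) : Learn S (q + 1)

namespace Learn

lemma mono {S : Set (Labeling h V)} {q : ℕ} (hS : Learn S q) {S' : Set (Labeling h V)} {q' : ℕ}
    (hS' : S' ⊆ S) (hq : q ≤ q') : Learn S' q' := by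
  induction hS generalizing S' q' with
  | done hS => exact done fun L hL L' hL' => hS L (hS' hL) L' (hS' hL')
  | ask u v _ _ ih₁ ih₂ =>
    obtain ⟨r, rfl⟩ : ∃ r, q' = r + 1 := ⟨q' - 1, by omega⟩
    exact ask u v (ih₁ (fun L hL => ⟨hS' hL.1, hL.2⟩) (by omega))
      (ih₂ (fun L hL => ⟨hS' hL.1, hL.2⟩) (by omega))

lemma of_forall_notMem {S : Set (Labeling h V)} {q : ℕ} (hS : ∀ L, L ∉ S) : Learn S q :=
  done fun L hL => absurd hL (hS L)

/-- Allows a representative of the class to guide the choice of queries; the resulting tree must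
still serve the whole class. -/
lemma of_forall_mem {S : Set (Labeling h V)} {q : ℕ} (hS : ∀ L ∈ S, Learn S q) : Learn S q := by
  by_cases hne : ∃ L, L ∈ S
  · obtain ⟨L, hL⟩ := hne
    exact hS L hL
  · exact of_forall_notMem fun L hL => hne ⟨L, hL⟩

/-- Asking all queries of `P`: then the network agrees on `P` with some `L₀` in the class. -/
lemma batch (P : Finset (V × V)) {S : Set (Labeling h V)} {q : ℕ}
    (hP : ∀ L₀ ∈ S, Learn {L | L ∈ S ∧ ∀ p ∈ P, L.le p.1 p.2 ↔ L₀.le p.1 p.2} q) :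
    Learn S (q + P.card) := by
  classical
  induction P using Finset.induction_on generalizing S with
  | empty =>
    refine of_forall_mem fun L₀ hL₀ => (hP L₀ hL₀).mono (fun L hL => ⟨hL, by simp⟩) le_rfl
  | insert p P hp ih =>
    rw [Finset.card_insert_of_notMem hp, ← add_assoc]
    refine ask p.1 p.2 (ih fun L₀ hL₀ => ?_) (ih fun L₀ hL₀ => ?_)
    · refine (hP L₀ hL₀.1).mono (fun L hL => ⟨hL.1.1, fun r hr => ?_⟩) le_rfl
      rcases Finset.mem_insert.1 hr with rfl | hr
      · exact iff_of_true hL.1.2 hL₀.2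
      · exact hL.2 r hr
    · refine (hP L₀ hL₀.1).mono (fun L hL => ⟨hL.1.1, fun r hr => ?_⟩) le_rfl
      rcases Finset.mem_insert.1 hr with rfl | hr
      · exact iff_of_false hL.1.2 hL₀.2
      · exact hL.2 r hr

/-- A query `(u, v)` to the reversed network is the query `(v, u)` to the network itself, so
everything shown for ancestors also serves for descendants. -/
lemma dual {S : Set (Labeling h V)} {q : ℕ} (hS : Learn S q) :
    Learn (Labeling.dual ⁻¹' S) q := by
  induction hS with
  | done hS =>
    refine done fun L hL L' hL' u v huv => ?_
    simpa using hS _ hL _ hL' v u (by simpa using huv)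
  | ask u v _ _ ih₁ ih₂ =>
    exact ask v u (ih₁.mono (fun L hL => by simpa using hL) le_rfl)
      (ih₂.mono (fun L hL => by simpa using hL) le_rfl)

lemma of_dual {S : Set (Labeling h V)} {q : ℕ} (hS : Learn (Labeling.dual ⁻¹' S) q) :
    Learn S q :=
  hS.dual.mono (fun L hL => by simpa using hL) le_rfl

/-- Finding the ancestors of `m`, which are known to belong to `X`. -/
lemma query_ancestors (X : Finset V) (m : V) {S : Set (Labeling h V)} {q : ℕ}
    (hX : ∀ L ∈ S, ∀ x, L.le x m → x ∈ X)
    (hS : ∀ S' ⊆ S, ∀ Y ⊆ X, (∀ L ∈ S', ∀ x, x ∈ Y ↔ L.le x m) → Learn S' q) :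
    Learn S (q + X.card) := by
  classical
  have := batch (X.image fun x => (x, m)) (S := S) (q := q) fun L₀ hL₀ =>
    hS _ (fun L hL => hL.1) (X.filter fun x => L₀.le x m) (Finset.filter_subset _ _)
      fun L hL x => by
        have h2 : x ∈ X → (L.le x m ↔ L₀.le x m) := fun hx =>
          hL.2 (x, m) (Finset.mem_image_of_mem _ hx)
        rw [Finset.mem_filter]
        exact ⟨fun hx => (h2 hx.1).2 hx.2, fun hx =>
          ⟨hX L hL.1 x hx, (h2 (hX L hL.1 x hx)).1 hx⟩⟩
  exact this.mono subset_rfl (by have := Finset.card_image_le (s := X) (f := fun x => (x, m)); omega)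

/-- At a leaf all labelings of the class have the same edges, so the graph of any one of them can be
output. -/
lemma exists_queryAlg {S : Set (Labeling h V)} {q : ℕ} (hS : Learn S q) :
    ∃ T : QueryAlg V, ∀ L ∈ S, ∀ G : Digraph V, (∀ u v, G.Adj u v ↔ L.adj u v) →
      T.run (pathQuery G) = G ∧ T.numQueries (pathQuery G) ≤ q := by
  have hle : ∀ L : Labeling h V, ∀ G : Digraph V, (∀ u v, G.Adj u v ↔ L.adj u v) →
      ∀ u v, pathQuery G u v = true ↔ L.le u v := by
    intro L G hG u v
    have : G.Adj = L.adj := by ext u v; exact hG u v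
    simp [pathQuery, this, Labeling.reflTransGen_adj_iff]
  induction hS with
  | @done S q hS =>
    by_cases hne : ∃ L, L ∈ S
    · obtain ⟨L₀, hL₀⟩ := hne
      refine ⟨.output ⟨L₀.adj⟩, fun L hL G hG => ⟨?_, by simp [QueryAlg.numQueries]⟩⟩
      ext u v
      simp only [QueryAlg.run]
      rw [hG]
      exact ⟨hS L₀ hL₀ L hL u v, hS L hL L₀ hL₀ u v⟩
    · exact ⟨.output ⟨fun _ _ => False⟩, fun L hL => absurd ⟨L, hL⟩ hne⟩
  | ask u v _ _ ih₁ ih₂ =>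
    obtain ⟨T₁, hT₁⟩ := ih₁
    obtain ⟨T₂, hT₂⟩ := ih₂
    refine ⟨.query u v fun b => if b then T₁ else T₂, fun L hL G hG => ?_⟩
    by_cases huv : L.le u v
    · have := (hle L G hG u v).2 huv
      obtain ⟨h1, h2⟩ := hT₁ L ⟨hL, huv⟩ G hG
      simp [QueryAlg.run, QueryAlg.numQueries, this, h1, h2]
    · have : pathQuery G u v = false := by
        rw [← Bool.not_eq_true, hle L G hG u v]; exact huv
      obtain ⟨h1, h2⟩ := hT₂ L ⟨hL, huv⟩ G hG
      simp [QueryAlg.run, QueryAlg.numQueries, this, h1, h2]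

end Learn
end Butterfly

/-! ### Finding in-neighbours and exploring upwards -/

namespace Butterfly

variable {h : ℕ} {V : Type*}

open Labeling

namespace Learn

/-- Finding the in-neighbour `p` of `m` above `x`, and the ancestors of `p`, when the set `X` of
the ancestors of `m` is known. -/
lemma find_parent {k : ℕ} (X : Finset V) {m x : V} (hx : x ∈ X) (hxm : x ≠ m)
    {S : Set (Labeling h V)} {q : ℕ} (hr : ∀ L ∈ S, L.rank m = k)
    (hX : ∀ L ∈ S, ∀ y, y ∈ X ↔ L.le y m)
    (hS : ∀ S' ⊆ S, ∀ p, ∀ Y ⊆ X,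
      (∀ L ∈ S', L.adj p m ∧ L.le x p ∧ ∀ y, y ∈ Y ↔ L.le y p) → Learn S' q) :
    Learn S (q + 2 * X.card + (k + 1) ^ 2) := by
  classical
  -- These answers reveal the interval from `x` to `m`, a path with at most `k + 1` vertices.
  have main := batch (X.image fun y => (x, y)) (S := S) (q := q + X.card + (k + 1) ^ 2)
    fun L₀ hL₀ => by
    have hP : ∀ L ∈ {L | L ∈ S ∧ ∀ p ∈ X.image fun y => (x, y), L.le p.1 p.2 ↔ L₀.le p.1 p.2},
        ∀ y, y ∈ X.filter (fun y => L₀.le x y) ↔ L.le x y ∧ L.le y m := by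
      intro L hL y
      rw [Finset.mem_filter, and_comm, hX L hL.1]
      refine and_congr_left fun hy => (hL.2 (x, y) (Finset.mem_image_of_mem _ ?_)).symm
      exact (hX L hL.1 y).2 hy
    set P := X.filter fun y => L₀.le x y with hPdef
    have hcard : P.card ≤ k + 1 := by
      have h1 : Set.InjOn L₀.rank P := by
        intro y hy z hz hyz
        obtain ⟨hy1, hy2⟩ := (hP L₀ ⟨hL₀, fun _ _ => Iff.rfl⟩ y).1 hy
        obtain ⟨hz1, hz2⟩ := (hP L₀ ⟨hL₀, fun _ _ => Iff.rfl⟩ z).1 hz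
        exact rank_injOn_interval hy1 hy2 hz1 hz2 hyz
      have h2 : ∀ y ∈ P, L₀.rank y ∈ Finset.range (k + 1) := by
        intro y hy
        obtain ⟨-, hy2⟩ := (hP L₀ ⟨hL₀, fun _ _ => Iff.rfl⟩ y).1 hy
        have := hy2.1
        rw [hr L₀ hL₀] at this
        exact Finset.mem_range.2 (by omega)
      simpa using Finset.card_le_card_of_injOn _ h2 h1
    -- All comparisons within the path reveal its order, hence its last vertex before `m`. The
    -- remaining `X.card` queries find the ancestors of that vertex.
    refine (batch (P ×ˢ P) (q := q + X.card) fun L₁ hL₁ => ?_).mono subset_rfl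
      (by rw [Finset.card_product, ← sq]; gcongr)
    obtain ⟨p, hp, hxp⟩ := exists_le_adj ((hX L₁ hL₁.1 x).1 hx) hxm
    have hpP : p ∈ P := (hP L₁ hL₁ p).2 ⟨hxp, hp.2⟩
    refine query_ancestors X p (fun L hL y hy => ?_) fun S' hS' Y hY hY' => hS S'
      (fun L hL => (hS' hL).1.1) p Y hY fun L hL => ?_
    · exact (hX L hL.1.1 y).2 (le_trans hy ((hP L hL.1 p).1 hpP).2)
    · have hL' := hS' hL
      obtain ⟨p', hp', hxp'⟩ := exists_le_adj ((hX L hL'.1.1 x).1 hx) hxm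
      have hpP' : p' ∈ P := (hP L hL'.1 p').2 ⟨hxp', hp'.2⟩
      have hne : p' ≠ m := by rintro rfl; have := hp'.1; omega
      have hne' : p ≠ m := by rintro rfl; have := hp.1; omega
      obtain ⟨h1, h2⟩ := (hP L₁ hL₁ p').1 hpP'
      obtain ⟨h3, h4⟩ := (hP L hL'.1 p).1 hpP
      have hle : L.le p' p :=
        (hL'.2 (p', p) (Finset.mem_product.2 ⟨hpP', hpP⟩)).2 (le_parent hp hxp h1 h2 hne)
      have hlt := rank_lt h4 hne'
      have := eq_of_le_of_rank hle (by have := hp'.1; omega)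
      exact ⟨this ▸ hp', h3, hY' L hL⟩
  have := Finset.card_image_le (s := X) (f := fun y => (x, y))
  exact main.mono subset_rfl (by omega)

end Learn

/-- In the class `S` the edges on the paths of length at most `d` to `m` are known. -/
def KnownUp (S : Set (Labeling h V)) (m : V) (d : ℕ) : Prop :=
  ∀ L ∈ S, ∀ L' ∈ S, ∀ k < d, ∀ x z, L.step k z m → L.adj x z → L'.adj x z

namespace KnownUp

lemma mono {S S' : Set (Labeling h V)} {m : V} {d : ℕ} (hm : KnownUp S m d) (hS : S' ⊆ S) :
    KnownUp S' m d := fun L hL L' hL' => hm L (hS hL) L' (hS hL')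

/-- Going back from `m`, each edge of a path transfers from one labeling of the class to any other.
-/
lemma step {S : Set (Labeling h V)} {m : V} {d : ℕ} (hm : KnownUp S m d)
    {L L' : Labeling h V} (hL : L ∈ S) (hL' : L' ∈ S) {k : ℕ} (hk : k ≤ d) {x : V}
    (hx : L.step k x m) : L'.step k x m := by
  induction k generalizing x with
  | zero => rw [step_zero hx]; exact step_refl _
  | succ k ih =>
    obtain ⟨z, hxz, hz⟩ := step_succ' hx
    exact adj_step (hm L hL L' hL' k (by omega) x z hz hxz) (ih (by omega) hz)

/-- If the edges near `m` are known, then so are those near an in-neighbour of `m`. -/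
lemma parent {S : Set (Labeling h V)} {m p : V} {d : ℕ} (hm : KnownUp S m (d + 1))
    (hp : ∀ L ∈ S, L.adj p m) : KnownUp S p d := fun L hL L' hL' k hk x z hz hx =>
  hm L hL L' hL' (k + 1) (by omega) x z (step_adj hz (hp L hL)) hx

end KnownUp

lemma add_one_sq_le_two_pow (k : ℕ) : (k + 1) ^ 2 ≤ 3 * 2 ^ k := by
  induction k with
  | zero => norm_num
  | succ k ih =>
    rcases Nat.lt_or_ge k 2 with hk | hk
    · interval_cases k <;> norm_num
    · rw [pow_succ 2 k]
      nlinarith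

namespace Learn

/-- Both in-neighbours of `m` are found and explored recursively. Their ancestor sets are disjoint
and half as large, so each of the `d` levels costs at most `14 * 2 ^ k` in total. -/
lemma explore_up [Fintype V] {d k : ℕ} (hd : d ≤ k) (X : Finset V) {m : V}
    {S : Set (Labeling h V)} {q : ℕ} (hr : ∀ L ∈ S, L.rank m = k)
    (hX : ∀ L ∈ S, ∀ y, y ∈ X ↔ L.le y m)
    (hS : ∀ S' ⊆ S, KnownUp S' m d → Learn S' q) : Learn S (q + 14 * d * 2 ^ k) := by
  classical
  induction d generalizing k m X S q with
  | zero => exact (hS S subset_rfl fun L _ L' _ k hk => by omega).mono subset_rfl (by omega)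
  | succ d ih =>
    obtain ⟨k, rfl⟩ : ∃ j, k = j + 1 := ⟨k - 1, by omega⟩
    refine of_forall_mem fun L₀ hL₀ => ?_
    have hcard : X.card ≤ 2 ^ (k + 1 + 1) := by
      have h1 := card_ancestors (hr L₀ hL₀)
      have h2 : X = Finset.univ.filter fun x => L₀.le x m := by ext x; simp [hX L₀ hL₀]
      rw [← h2] at h1
      omega
    have hsq := add_one_sq_le_two_pow (k + 1)
    obtain ⟨x, -, -, hx, -⟩ := exists_two_parents (L := L₀) (m := m) (by rw [hr L₀ hL₀]; omega)
    have hxm : x ≠ m := by rintro rfl; have := hx.1; omega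
    have main : Learn S (q + 14 * d * 2 ^ k + 14 * d * 2 ^ k + 2 * X.card + (k + 1 + 1) ^ 2 +
        2 * X.card + (k + 1 + 1) ^ 2) := by
      refine find_parent X ((hX L₀ hL₀ x).2 hx.2) hxm hr hX fun S₁ hS₁ p Y hYX hp => ?_
      refine of_forall_mem fun L₁ hL₁ => ?_
      -- Starting from an ancestor of `m` that is not one of `p` forces the second search to find
      -- the other in-neighbour.
      obtain ⟨x', hx', hx'p⟩ : ∃ x', L₁.adj x' m ∧ ¬ L₁.le x' p := by
        obtain ⟨a, b, hab, ha, hb, -⟩ := exists_two_parents (L := L₁) (m := m)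
          (by rw [hr L₁ (hS₁ hL₁)]; omega)
        have hp1 := (hp L₁ hL₁).1
        by_cases hap : L₁.le a p
        · refine ⟨b, hb, fun hbp => hab ?_⟩
          rw [parent_unique ha hp1 (le_refl a) hap, parent_unique hb hp1 (le_refl b) hbp]
        · exact ⟨a, ha, hap⟩
      have hxm' : x' ≠ m := by rintro rfl; have := hx'.1; omega
      refine find_parent X ((hX L₁ (hS₁ hL₁) x').2 hx'.2) hxm' (fun L hL => hr L (hS₁ hL))
        (fun L hL => hX L (hS₁ hL)) fun S₂ hS₂ p' Y' hYX' hp' => ?_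
      refine ih (by omega) Y (fun L hL => ?_) (fun L hL => (hp L (hS₂ hL)).2.2)
        fun S₃ hS₃ hk₃ => ?_
      · have h1 := (hp L (hS₂ hL)).1.1
        have h2 := hr L (hS₁ (hS₂ hL))
        omega
      refine ih (by omega) Y' (fun L hL => ?_) (fun L hL => (hp' L (hS₃ hL)).2.2)
        fun S₄ hS₄ hk₄ => hS S₄ (fun L hL => hS₁ (hS₂ (hS₃ (hS₄ hL)))) ?_
      · have h1 := (hp' L (hS₃ hL)).1.1
        have h2 := hr L (hS₁ (hS₂ (hS₃ hL)))
        omega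
      have hpp : ∀ L ∈ S₄, ∀ r, L.adj r m → r = p ∨ r = p' := by
        intro L hL r hr'
        have hL3 := hS₄ hL
        have hL2 := hS₃ hL3
        have h1 := hp L (hS₂ hL2)
        have h2 := hp' L hL2
        have hne : p ≠ p' := by
          rintro rfl
          exact hx'p (((hp L₁ hL₁).2.2 x').1 ((h1.2.2 x').2 h2.2.1))
        obtain ⟨a, b, -, -, -, hall⟩ := exists_two_parents (L := L) (m := m)
          (by rw [hr L (hS₁ (hS₂ hL2))]; omega)
        rcases hall p h1.1 with h3 | h3 <;> rcases hall p' h2.1 with h4 | h4 <;>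
          rcases hall r hr' with h5 | h5 <;> subst h3 <;> subst h5 <;> simp_all
      intro L hL L' hL' j hj y z hz hy
      cases j with
      | zero =>
        rw [step_zero hz] at hy ⊢
        rcases hpp L hL y hy with rfl | rfl
        · exact (hp L' (hS₂ (hS₃ (hS₄ hL')))).1
        · exact (hp' L' (hS₃ (hS₄ hL'))).1
      | succ j =>
        obtain ⟨r, hzr, hr'⟩ := step_succ hz
        rcases hpp L hL r hr' with rfl | rfl
        · exact hk₃ L (hS₄ hL) L' (hS₄ hL') j (by omega) y z hzr hy
        · exact hk₄ L hL L' hL' j (by omega) y z hzr hy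
    refine main.mono subset_rfl ?_
    -- The constant is `8 + 6`: four passes over `X`, of size at most `2 * 2 ^ (k + 1)`, and two
    -- sortings of at most `3 * 2 ^ (k + 1)` queries each.
    have h2 : 14 * (d + 1) * 2 ^ (k + 1) =
        14 * d * 2 ^ k + 14 * d * 2 ^ k + 14 * 2 ^ (k + 1) := by ring
    rw [pow_succ 2 (k + 1)] at hcard
    omega

end Learn
end Butterfly

/-! ### Learning all twins of a vertex at once -/

namespace Butterfly

variable {h : ℕ} {V : Type*}

open Labeling

namespace Learn

/-- Learning all out-edges of all twins of a vertex `v` of small rank. -/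
lemma learn_twins [Fintype V] {w j : ℕ} {v : V} {S : Set (Labeling h V)} {q : ℕ}
    (hr : ∀ L ∈ S, L.rank v = j) (hj : j + (w + 1) ≤ h)
    (hS : ∀ S' ⊆ S, ∀ C : Finset V, (∀ L ∈ S', ∀ x, x ∈ C ↔ L.twin (w + 1) v x) →
      (∀ L ∈ S', ∀ L' ∈ S', ∀ x ∈ C, ∀ z, L.adj x z → L'.adj x z) → Learn S' q) :
    Learn S (q + 3 * Fintype.card V + 42 * (w + 1) * 2 ^ h) := by
  classical
  have up : ∀ m, ∀ {S : Set (Labeling h V)} {q : ℕ}, (∀ L ∈ S, L.rank m = j + (w + 1)) →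
      (∀ S' ⊆ S, KnownUp S' m (w + 1) → Learn S' q) →
      Learn S (q + 14 * (w + 1) * 2 ^ h + Fintype.card V) := by
    intro m S q hr hS
    refine query_ancestors Finset.univ m (fun _ _ _ _ => Finset.mem_univ _)
      fun S' hS' Y _ hY => ?_
    refine (explore_up (by omega) Y (fun L hL => hr L (hS' hL)) hY
      fun S'' hS'' => hS S'' (hS''.trans hS')).mono subset_rfl ?_
    gcongr
    norm_num
  have main : Learn S (q + 14 * (w + 1) * 2 ^ h + Fintype.card V + 14 * (w + 1) * 2 ^ h +
      Fintype.card V + 14 * (w + 1) * 2 ^ (h - j) + Fintype.card V) := by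
    refine of_dual (query_ancestors Finset.univ v (fun _ _ _ _ => Finset.mem_univ _)
      fun S₁ hS₁ Y _ hY => ?_)
    refine explore_up (by omega) Y (fun L hL => ?_) hY fun S₂ hS₂ hk => of_dual ?_
    · have h1 : L.dual.rank v = j := hr _ (hS₁ hL)
      have h2 := L.rank_le v
      rw [rank_dual] at h1
      omega
    have hS₃ : Labeling.dual ⁻¹' S₂ ⊆ S := fun L hL => by
      have : L.dual.dual ∈ S := hS₁ (hS₂ hL)
      rwa [dual_dual] at this
    refine of_forall_mem fun L₀ hL₀ => ?_
    have hr₀ := hr L₀ (hS₃ hL₀)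
    obtain ⟨c, c', hcc, hc, hc', -⟩ := exists_two_parents (L := L₀.dual) (m := v)
      (by rw [rank_dual]; omega)
    rw [adj_dual] at hc hc'
    have child : ∀ c, L₀.adj v c → ∀ L ∈ Labeling.dual ⁻¹' S₂, L.adj v c := fun c hc L hL => by
      have := hk.step hL₀ hL (k := 1) (by omega) (L₀.step_dual.2 hc)
      rwa [step_dual] at this
    -- The downward exploration has fixed the edges near `v`, so a descendant chosen in `L₀` is
    -- valid in the whole class.
    have desc : ∀ c, L₀.adj v c → ∃ m, ∀ L ∈ Labeling.dual ⁻¹' S₂, L.step w c m := by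
      intro c hc
      obtain ⟨m, hm⟩ := exists_step (L := L₀) (u := c) (k := w) (by have := hc.1; omega)
      refine ⟨m, fun L hL => ?_⟩
      have hkc : KnownUp S₂ c w := hk.parent fun L hL => by
        have := child c hc L.dual (by simpa using hL)
        simpa using this
      simpa using hkc.step hL₀ hL le_rfl (L₀.step_dual.2 hm)
    obtain ⟨m, hm⟩ := desc c hc
    obtain ⟨m', hm'⟩ := desc c' hc'
    have hvm : ∀ L ∈ Labeling.dual ⁻¹' S₂, L.step (w + 1) v m := fun L hL =>
      adj_step (child c hc L hL) (hm L hL)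
    have hvm' : ∀ L ∈ Labeling.dual ⁻¹' S₂, L.step (w + 1) v m' := fun L hL =>
      adj_step (child c' hc' L hL) (hm' L hL)
    refine up m (fun L hL => ?_) fun S₄ hS₄ hk₄ => up m' (fun L hL => ?_) fun S₅ hS₅ hk₅ => ?_
    · rw [(hvm L hL).1, hr L (hS₃ hL)]
    · rw [(hvm' L (hS₄ hL)).1, hr L (hS₃ (hS₄ hL))]
    refine of_forall_mem fun L₁ hL₁ => hS S₅ ((hS₅.trans hS₄).trans hS₃)
      (Finset.univ.filter fun x => L₁.twin (w + 1) v x) (fun L hL x => ?_)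
      fun L hL L' hL' x hx z hz => ?_
    · rw [Finset.mem_filter, twin_iff_step (hvm L (hS₄ (hS₅ hL))),
        twin_iff_step (hvm L₁ (hS₄ (hS₅ hL₁)))]
      exact ⟨fun hx => hk₄.step (hS₅ hL₁) (hS₅ hL) le_rfl hx.2,
        fun hx => ⟨Finset.mem_univ _, hk₄.step (hS₅ hL) (hS₅ hL₁) le_rfl hx⟩⟩
    · have hL3 := hS₄ (hS₅ hL)
      have hxL : L.twin (w + 1) v x := by
        rw [twin_iff_step (hvm L hL3)]
        refine hk₄.step (hS₅ hL₁) (hS₅ hL) le_rfl ?_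
        rw [← twin_iff_step (hvm L₁ (hS₄ (hS₅ hL₁)))]
        exact (Finset.mem_filter.1 hx).2
      -- Every out-edge of a twin lies on a path of length `w + 1` to `m` or to `m'`, and both
      -- upward explorations reach that far.
      rcases twin_adj_step hcc (child c hc L hL3) (child c' hc' L hL3) (hm L hL3) (hm' L hL3)
        hxL hz with h1 | h1
      · exact hk₄ L (hS₅ hL) L' (hS₅ hL') w (by omega) x z h1 hz
      · exact hk₅ L hL L' hL' w (by omega) x z h1 hz
  refine main.mono subset_rfl ?_
  have h1 : 14 * (w + 1) * 2 ^ (h - j) ≤ 14 * (w + 1) * 2 ^ h := by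
    gcongr
    · norm_num
    · omega
  have h2 : 42 * (w + 1) * 2 ^ h = 3 * (14 * (w + 1) * 2 ^ h) := by ring
  omega

end Learn

/-! ### Partition into groups and the total cost -/

/-- The class of vertices that are processed together with `v`: its twins, in the network if
the rank of `v` is small and in the reversed network otherwise. -/
def Labeling.group (L : Labeling h V) (w : ℕ) (v x : V) : Prop :=
  (L.rank v + w ≤ h ∧ L.twin w v x) ∨ (h < L.rank v + w ∧ L.dual.twin w v x)

lemma Labeling.group_rank {L : Labeling h V} {w : ℕ} {v x : V} (hx : L.group w v x) :
    L.rank x = L.rank v := by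
  have h1 := L.rank_le v
  have h2 := L.rank_le x
  rcases hx with ⟨-, hx⟩ | ⟨-, hx⟩
  · exact hx.1
  · have := hx.1
    simp only [rank_dual] at this
    omega

lemma Labeling.group_symm {L : Labeling h V} {w : ℕ} {v x : V} (hx : L.group w v x) :
    L.group w x v := by
  have hr := group_rank hx
  rcases hx with ⟨h1, hx⟩ | ⟨h1, hx⟩
  · exact Or.inl ⟨by omega, twin_symm hx⟩
  · exact Or.inr ⟨by omega, twin_symm hx⟩

lemma Labeling.group_trans {L : Labeling h V} {w : ℕ} {u v x : V} (hv : L.group w u v)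
    (hx : L.group w u x) : L.group w v x := by
  have trans : ∀ M : Labeling h V, M.twin w u v → M.twin w u x → M.twin w v x :=
    fun M hv hx => ⟨hx.1.trans hv.1.symm, fun i hi => by
      rw [hv.1] at hi
      rw [← hv.2 i hi, hx.2 i hi]⟩
  have hr := group_rank hv
  rcases hv with ⟨h1, hv⟩ | ⟨h1, hv⟩ <;> rcases hx with ⟨h2, hx⟩ | ⟨h2, hx⟩
  · exact Or.inl ⟨by omega, trans L hv hx⟩
  · omega
  · omega
  · exact Or.inr ⟨by omega, trans L.dual hv hx⟩

-- The condition `2 * w ≤ h + 1` ensures that a vertex with fewer than `w` layers after its own has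
-- at least `w` layers before it, so that the reversed network has room for its twins.
open Classical in
lemma Labeling.card_group [Fintype V] (L : Labeling h V) {w : ℕ} (hw : 2 * w ≤ h + 1) (v : V) :
    (Finset.univ.filter fun x => L.group w v x).card = 2 ^ w := by
  by_cases hv : L.rank v + w ≤ h
  · rw [← card_twin hv]
    congr 1
    ext x
    simp [group, hv]
  · rw [← card_twin (L := L.dual) (v := v) (by have := L.rank_le v; rw [rank_dual]; omega)]
    congr 1
    ext x
    simp [group, hv, not_le.1 hv]

/-- In the class `S` the out-edges of `u` are known if the rank of `u` is small, and its in-edges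
otherwise. -/
def KnownAt (S : Set (Labeling h V)) (w : ℕ) (u : V) : Prop :=
  ∀ L ∈ S, ∀ L' ∈ S, (L.rank u + w ≤ h → ∀ z, L.adj u z → L'.adj u z) ∧
    (h < L.rank u + w → ∀ z, L.adj z u → L'.adj z u)

namespace Learn

lemma learn_group [Fintype V] {w : ℕ} (hw : 1 ≤ w) (hwh : 2 * w ≤ h + 1) (v : V)
    {S : Set (Labeling h V)} {q : ℕ}
    (hS : ∀ S' ⊆ S, ∀ C : Finset V, (∀ L ∈ S', ∀ x, x ∈ C ↔ L.group w v x) →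
      (∀ x ∈ C, KnownAt S' w x) → Learn S' q) :
    Learn S (q + (4 * Fintype.card V + 42 * w * 2 ^ h)) := by
  classical
  obtain ⟨w, rfl⟩ : ∃ w', w = w' + 1 := ⟨w - 1, by omega⟩
  have main : Learn S (q + 3 * Fintype.card V + 42 * (w + 1) * 2 ^ h + Fintype.card V) := by
    refine query_ancestors Finset.univ v (fun _ _ _ _ => Finset.mem_univ _)
      fun S₁ hS₁ Y _ hY => of_forall_mem fun L₀ hL₀ => ?_
    -- The number `2 ^ (r + 1) - 1` of ancestors determines the rank `r`.
    have hr : ∀ L ∈ S₁, L.rank v = L₀.rank v := by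
      have hcard : ∀ L ∈ S₁, Y.card + 1 = 2 ^ (L.rank v + 1) := fun L hL => by
        rw [← card_ancestors (L := L) rfl]
        congr 2
        ext x
        simp [hY L hL]
      intro L hL
      have := Nat.pow_right_injective le_rfl ((hcard L hL).symm.trans (hcard L₀ hL₀))
      omega
    have hv := L₀.rank_le v
    by_cases hj : L₀.rank v + (w + 1) ≤ h
    · refine learn_twins hr hj fun S' hS' C hC hadj => hS S' (hS'.trans hS₁) C
        (fun L hL x => ?_) fun x hx L hL L' hL' => ⟨fun _ => hadj L hL L' hL' x hx, ?_⟩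
      · rw [hC L hL, group, hr L (hS' hL)]
        exact ⟨fun hx => Or.inl ⟨hj, hx⟩, fun hx => hx.elim (·.2) fun h' => by omega⟩
      · have h1 := ((hC L hL x).1 hx).1
        have h2 := hr L (hS' hL)
        omega
    · refine of_dual (learn_twins (w := w) (v := v) (j := h - L₀.rank v) (fun L hL => ?_)
        (by omega) fun S' hS' C hC hadj => of_dual ?_)
      · have h1 : L.dual.rank v = L₀.rank v := hr _ hL
        have h2 := L.rank_le v
        rw [rank_dual] at h1
        omega
      have hsub : Labeling.dual ⁻¹' S' ⊆ S₁ := fun L hL => by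
        have : L.dual.dual ∈ S₁ := hS' hL
        rwa [dual_dual] at this
      refine hS _ (hsub.trans hS₁) C (fun L hL x => ?_) fun x hx L hL L' hL' =>
        ⟨?_, fun _ z hz => ?_⟩
      · rw [hC L.dual hL, group, hr L (hsub hL)]
        exact ⟨fun hx => Or.inr ⟨by omega, hx⟩, fun hx => hx.elim (fun h' => by omega) (·.2)⟩
      · have h1 := ((hC L.dual hL x).1 hx).1
        have h2 := hr L (hsub hL)
        have h3 := L.rank_le x
        simp only [rank_dual] at h1
        omega
      · simpa using hadj L.dual hL L'.dual hL' x hx z (by simpa using hz)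
  exact main.mono subset_rfl (by omega)

/-- `U` is a union of groups already processed, and `T` bounds the number of groups left. A new
group is disjoint from `U` and removes `2 ^ w` vertices from its complement. -/
lemma learn_all [Fintype V] [DecidableEq V] {w : ℕ} (hw : 1 ≤ w) (hwh : 2 * w ≤ h + 1) (T : ℕ)
    {S : Set (Labeling h V)} (U : Finset V)
    (hU : ∀ L ∈ S, ∀ u ∈ U, ∀ x, L.group w u x → x ∈ U) (hk : ∀ u ∈ U, KnownAt S w u)
    (hcard : Uᶜ.card ≤ T * 2 ^ w) :
    Learn S (T * (4 * Fintype.card V + 42 * w * 2 ^ h)) := by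
  induction T generalizing S U with
  | zero =>
    have hall : ∀ u, u ∈ U := by
      have : Uᶜ = ∅ := Finset.card_eq_zero.1 (by omega)
      intro u
      rw [Finset.compl_eq_empty_iff] at this
      simp [this]
    refine done fun L hL L' hL' u z huz => ?_
    -- An edge starting at small rank is known from its start; otherwise its end has large rank too,
    -- and the edge is known from there.
    by_cases hr : L.rank u + w ≤ h
    · exact (hk u (hall u) L hL L' hL').1 hr z huz
    · exact (hk z (hall z) L hL L' hL').2 (by have := huz.1; omega) u huz
  | succ T ih =>
    by_cases hne : ∃ v, v ∉ U
    · obtain ⟨v, hv⟩ := hne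
      rw [add_mul, one_mul]
      refine learn_group hw hwh v fun S' hS' C hC hCk => of_forall_mem fun L₀ hL₀ =>
        ih (U ∪ C) (fun L hL u hu x hx => ?_) (fun u hu => ?_) ?_
      · rcases Finset.mem_union.1 hu with hu | hu
        · exact Finset.mem_union_left _ (hU L (hS' hL) u hu x hx)
        · refine Finset.mem_union_right _ ((hC L hL x).2 ?_)
          exact group_trans (group_symm ((hC L hL u).1 hu)) hx
      · rcases Finset.mem_union.1 hu with hu | hu
        · exact fun L hL L' hL' => hk u hu L (hS' hL) L' (hS' hL')
        · exact hCk u hu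
      · have h1 : C.card = 2 ^ w := by
          classical
          rw [← L₀.card_group hwh v]
          congr 1
          ext x
          simp [hC L₀ hL₀]
        have h2 : C ⊆ Uᶜ := fun x hx => by
          rw [Finset.mem_compl]
          exact fun hxU => hv (hU L₀ (hS' hL₀) x hxU v (group_symm ((hC L₀ hL₀ x).1 hx)))
        have h3 : (U ∪ C)ᶜ = Uᶜ \ C := by
          ext x
          simp
        rw [h3, Finset.card_sdiff_of_subset h2, h1]
        rw [add_mul] at hcard
        omega
    · exact (ih U hU hk (by
        have : U = Finset.univ := by
          ext u; simpa using not_exists_not.1 hne u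
        simp [this])).mono subset_rfl (Nat.mul_le_mul_right _ (by omega))

/-- Butterfly networks of height `h` can be learned with at most `100 h² 2 ^ (2 h - ⌈h / 2⌉)`
queries. -/
lemma learn_univ [Fintype V] :
    Learn (Set.univ : Set (Labeling h V)) (100 * h ^ 2 * 2 ^ (2 * h - (h + 1) / 2)) := by
  classical
  rcases Nat.eq_zero_or_pos h with rfl | hpos
  · refine done fun L _ L' _ u z huz => ?_
    have h1 := huz.1
    have h2 := L.rank_le z
    omega
  refine of_forall_mem fun L₀ _ => ?_
  have hn := L₀.card_le
  have hw : (h + 1) / 2 ≤ h := by omega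
  have hw1 : 1 ≤ (h + 1) / 2 := by omega
  have hw2 : 2 * ((h + 1) / 2) ≤ h + 1 := by omega
  generalize (h + 1) / 2 = w at *
  refine (learn_all hw1 hw2 ((h + 1) * 2 ^ (h - w)) ∅ (by simp) (by simp) ?_).mono
    subset_rfl ?_
  · rw [mul_assoc, ← pow_add, Nat.sub_add_cancel hw]
    simpa using hn
  -- The constant is `2 * (4 * 2 + 42) = 100`, using `h + 1 ≤ 2 * h` for both the number of groups
  -- and the size of `V`.
  · calc (h + 1) * 2 ^ (h - w) * (4 * Fintype.card V + 42 * w * 2 ^ h)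
        ≤ (2 * h) * 2 ^ (h - w) * (4 * ((2 * h) * 2 ^ h) + 42 * h * 2 ^ h) := by
          have : h + 1 ≤ 2 * h := by omega
          have := hn.trans (Nat.mul_le_mul_right _ this)
          gcongr
      _ = 100 * h ^ 2 * (2 ^ (h - w) * 2 ^ h) := by ring
      _ = 100 * h ^ 2 * 2 ^ (2 * h - w) := by
          rw [← pow_add]
          congr 2
          omega

end Learn
end Butterfly

theorem mainTheorem5 (c : ℕ) :
    ∃ C : ℝ, ∀ (h : ℕ) (V : Type*) [Fintype V],
      ∃ A : RandQueryAlg V, ∀ G : Digraph V, IsButterfly h G →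
        A.QueriesAtMost G (C * ((2 : ℝ) ^ (3 * (h : ℝ) / 2) * (h : ℝ) ^ 2)) ∧
        1 - 1 / (Fintype.card V : ℝ) ^ c ≤ A.successProb G := by
  refine ⟨100, fun h V _ => ?_⟩
  obtain ⟨T, hT⟩ := (Butterfly.Learn.learn_univ (h := h) (V := V)).exists_queryAlg
  -- No randomness is needed: a point mass succeeds with probability `1`, so the constant `100` does
  -- not depend on `c`.
  refine ⟨PMF.pure T, fun G hG => ?_⟩
  obtain ⟨L, hL⟩ := Butterfly.exists_labeling hG
  obtain ⟨hrun, hnum⟩ := hT L (Set.mem_univ L) G hL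
  constructor
  · intro T' hT'
    rw [PMF.support_pure, Set.mem_singleton_iff] at hT'
    subst hT'
    have hpow : (2 : ℝ) ^ (2 * h - (h + 1) / 2) ≤ (2 : ℝ) ^ (3 * (h : ℝ) / 2) := by
      rw [← Real.rpow_natCast]
      refine Real.rpow_le_rpow_of_exponent_le (by norm_num) ?_
      rw [le_div_iff₀ (by norm_num)]
      have : (2 * h - (h + 1) / 2) * 2 ≤ 3 * h := by omega
      exact_mod_cast this
    calc (T'.numQueries (pathQuery G) : ℝ)
        ≤ ((100 * h ^ 2 * 2 ^ (2 * h - (h + 1) / 2) : ℕ) : ℝ) := by exact_mod_cast hnum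
      _ = 100 * ((2 : ℝ) ^ (2 * h - (h + 1) / 2) * (h : ℝ) ^ 2) := by push_cast; ring
      _ ≤ _ := by gcongr
  · have : RandQueryAlg.successProb (PMF.pure T) G = 1 := by
      simp [RandQueryAlg.successProb, PMF.toOuterMeasure_pure_apply, hrun]
    rw [this]
    have : (0 : ℝ) ≤ 1 / (Fintype.card V : ℝ) ^ c := by positivity
    linarith
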